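/- Let $(M,\mathrm{dist})$ be a compact metric space without isolated points and let $f:M\to M$ be an expansive homeomorphism, i.e. there is $\alpha>0$ such that for all $x\neq y$ in $M$ there is $n\in\mathbb Z$ with $\mathrm{dist}(f^n(x),f^n(y))>\alpha$. Let $d$ be an adapted metric for $f$ in the sense of Fathi, i.e. a metric on $M$ defining the same topology as $\mathrm{dist}$, such that $f$ and $f^{-1}$ are Lipschitz for $d$ and such that there are $k>1$ and $\varepsilon_0>0$ with $$\max\{d(f(x),f(y)),\,d(f^{-1}(x),f^{-1}(y))\}\ \ge\ \min\{k\,d(x,y),\,\varepsilon_0\}\qquad\text{for all }x,y\in M.$$ For $\delta>0$, $n\in\mathbb Z$ and $x\in M$ let $$B_x^*(\delta,n)=\{y\in M\setminus\{x\}: d(f^j(x),f^j(y))\le\delta\ \text{ for all integers } j \text{ between } 0 \text{ and } n\ \text{(inclusive)}\},$$ $$A_\delta(x,n)=\sup_{y\in B_x^*(\delta,n)}\frac{d(f^n(x),f^n(y))}{d(x,y)},\qquad a_\delta(x,n)=\inf_{y\in B_x^*(\delta,n)}\frac{d(f^n(x),f^n(y))}{d(x,y)}.$$ Let $\mu$ be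 an $f$-invariant Borel probability measure on $M$. Then for every $\delta>0$ the functions $x\mapsto A_\delta(x,n)$ and $x\mapsto a_\delta(x,n)$ are Borel measurable for every $n\in\mathbb Z$, and $$\sup_{n\in\mathbb Z\setminus\{0\}}\frac1{|n|}\int_M|\log A_\delta(x,n)|\,\mu(dx)<\infty,\qquad \sup_{n\in\mathbb Z\setminus\{0\}}\frac1{|n|}\int_M|\log a_\delta(x,n)|\,\mu(dx)<\infty;$$ in particular $$\left|\inf_{n\in\mathbb Z\setminus\{0\}}\frac1{|n|}\int_M|\log a_\delta(x,n)|\,\mu(dx)\right|<\infty.$$ -/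

import Mathlib

open MeasureTheory
open scoped ENNReal Topology

/-- A homeomorphism `f` of a metric space is expansive if some `α > 0` has the property that any two
distinct points are moved to distance more than `α` by some iterate `f ^ n`, `n ∈ ℤ`. -/
def IsExpansiveHomeo {M : Type*} [MetricSpace M] (f : M ≃ₜ M) : Prop :=
  ∃ α : ℝ, 0 < α ∧ ∀ x y : M, x ≠ y → ∃ n : ℤ, α < dist ((f ^ n) x) ((f ^ n) y)

/-- The distance function `d` is an adapted (hyperbolic) metric, in the sense of Fathi, for the
homeomorphism `f` of the topological space `M`. -/
structure IsAdaptedMetric {M : Type*} [t : TopologicalSpace M] (f : M ≃ₜ M) (d : M → M → ℝ) :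
    Prop where
  /-- `d` is a metric, and it defines the given topology of `M` -/
  isMetric : ∃ m : MetricSpace M, m.toUniformSpace.toTopologicalSpace = t ∧
    ∀ x y : M, d x y = m.dist x y
  /-- one of `f`, `f⁻¹` expands small distances by a factor at least `k > 1` -/
  expanding : ∃ k ε₀ : ℝ, 1 < k ∧ 0 < ε₀ ∧ ∀ x y : M,
    min (k * d x y) ε₀ ≤ max (d (f x) (f y)) (d (f.symm x) (f.symm y))
  /-- `f` is Lipschitz for `d` -/
  lipschitz : ∃ K : ℝ, ∀ x y : M, d (f x) (f y) ≤ K * d x y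
  /-- `f⁻¹` is Lipschitz for `d` -/
  lipschitz_symm : ∃ K : ℝ, ∀ x y : M, d (f.symm x) (f.symm y) ≤ K * d x y

/-- The punctured dynamical ball `B*_x(δ, n)` for the distance function `d`: all `y ≠ x` such that
`d (f^j x) (f^j y) ≤ δ` for every integer `j` between `0` and `n` (whatever the sign of `n`). -/
def puncturedBowenBall {M : Type*} [TopologicalSpace M] (d : M → M → ℝ) (f : M ≃ₜ M)
    (δ : ℝ) (x : M) (n : ℤ) : Set M :=
  {y | y ≠ x ∧ ∀ j ∈ Set.uIcc (0 : ℤ) n, d ((f ^ j) x) ((f ^ j) y) ≤ δ}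

/-- The maximal distortion `A_δ(x, n)`, as an extended nonnegative real. -/
noncomputable def maxDistortion {M : Type*} [TopologicalSpace M] (d : M → M → ℝ) (f : M ≃ₜ M)
    (δ : ℝ) (x : M) (n : ℤ) : ℝ≥0∞ :=
  ⨆ y ∈ puncturedBowenBall d f δ x n, ENNReal.ofReal (d ((f ^ n) x) ((f ^ n) y) / d x y)

/-- The minimal distortion `a_δ(x, n)`, as an extended nonnegative real. -/
noncomputable def minDistortion {M : Type*} [TopologicalSpace M] (d : M → M → ℝ) (f : M ≃ₜ M)
    (δ : ℝ) (x : M) (n : ℤ) : ℝ≥0∞ :=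
  ⨅ y ∈ puncturedBowenBall d f δ x n, ENNReal.ofReal (d ((f ^ n) x) ((f ^ n) y) / d x y)

/-- For `g : M → [0, ∞]` and `n ∈ ℤ \ {0}`: the number `(1 / |n|) ∫ |log g| dμ` in `[0, ∞]`, where
`log 0 = -∞` and `log ∞ = ∞`. -/
noncomputable def meanAbsLog {M : Type*} [MeasurableSpace M] (μ : Measure M) (g : M → ℝ≥0∞)
    (n : ℤ) : ℝ≥0∞ :=
  (n.natAbs : ℝ≥0∞)⁻¹ * ∫⁻ x, (ENNReal.log (g x)).abs ∂μ

/-- The supremum over `n ∈ ℤ \ {0}` of `(1 / |n|) ∫ |log (g n)| dμ`, in `[0, ∞]`. -/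
noncomputable def supMeanAbsLog {M : Type*} [MeasurableSpace M] (μ : Measure M)
    (g : ℤ → M → ℝ≥0∞) : ℝ≥0∞ :=
  ⨆ (n : ℤ) (_ : n ≠ 0), meanAbsLog μ (g n) n

/-- The infimum over `n ∈ ℤ \ {0}` of `(1 / |n|) ∫ |log (g n)| dμ`, in `[0, ∞]`. -/
noncomputable def infMeanAbsLog {M : Type*} [MeasurableSpace M] (μ : Measure M)
    (g : ℤ → M → ℝ≥0∞) : ℝ≥0∞ :=
  ⨅ (n : ℤ) (_ : n ≠ 0), meanAbsLog μ (g n) n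

/-! If `K ≥ 1` is a Lipschitz constant for both `f` and `f⁻¹`, every distortion quotient at time `n`
lies in `[K^(-|n|), K^|n|]`. Since `M` has no isolated points, the punctured balls are nonempty, so
the supremum and infimum lie there too. Hence `|log| ≤ |n| log K` pointwise, and integrating against
a probability measure bounds all the means by `log K`.

For measurability, a strict sublevel or superlevel set is the projection to `M` of a closed set
intersected with an open one in `M × M`. Such a set is σ-compact by compactness, so its projection
is Borel. -/

theorem IsAdaptedMetric.continuous_uncurry {M : Type*} [t : TopologicalSpace M] {f : M ≃ₜ M}
    {d : M → M → ℝ} (hd : IsAdaptedMetric f d) : Continuous fun p : M × M => d p.1 p.2 := by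
  obtain ⟨m, rfl, h⟩ := hd.isMetric
  simp only [h]
  exact continuous_dist

theorem IsAdaptedMetric.self_eq_zero {M : Type*} [TopologicalSpace M] {f : M ≃ₜ M}
    {d : M → M → ℝ} (hd : IsAdaptedMetric f d) (x : M) : d x x = 0 := by
  obtain ⟨m, -, h⟩ := hd.isMetric
  rw [h, dist_self]

theorem IsAdaptedMetric.pos_of_ne {M : Type*} [TopologicalSpace M] {f : M ≃ₜ M}
    {d : M → M → ℝ} (hd : IsAdaptedMetric f d) {x y : M} (hxy : x ≠ y) : 0 < d x y := by
  obtain ⟨m, -, h⟩ := hd.isMetric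
  rw [h]
  exact dist_pos.2 hxy

theorem IsAdaptedMetric.nonneg {M : Type*} [TopologicalSpace M] {f : M ≃ₜ M}
    {d : M → M → ℝ} (hd : IsAdaptedMetric f d) (x y : M) : 0 ≤ d x y := by
  obtain ⟨m, -, h⟩ := hd.isMetric
  rw [h]
  exact dist_nonneg

/-- A common Lipschitz constant for all iterates, growing exponentially in `|n|`. -/
theorem IsAdaptedMetric.exists_lipschitz_zpow {M : Type*} [TopologicalSpace M] {f : M ≃ₜ M}
    {d : M → M → ℝ} (hd : IsAdaptedMetric f d) :
    ∃ K : ℝ, 1 ≤ K ∧ ∀ (n : ℤ) (x y : M), d ((f ^ n) x) ((f ^ n) y) ≤ K ^ n.natAbs * d x y := by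
  obtain ⟨K₁, h₁⟩ := hd.lipschitz
  obtain ⟨K₂, h₂⟩ := hd.lipschitz_symm
  set K := max 1 (max K₁ K₂) with hK
  have hK1 : 1 ≤ K := le_max_left _ _
  have iter : ∀ g : M ≃ₜ M, (∀ x y, d (g x) (g y) ≤ K * d x y) →
      ∀ (m : ℕ) (x y : M), d ((g ^ m) x) ((g ^ m) y) ≤ K ^ m * d x y := by
    intro g hg m
    induction m with
    | zero => intro x y; simp
    | succ m ih =>
      intro x y
      rw [pow_succ, pow_succ, mul_assoc]
      exact (ih (g x) (g y)).trans (mul_le_mul_of_nonneg_left (hg x y) (by positivity))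
  have hf : ∀ x y, d (f x) (f y) ≤ K * d x y := fun x y => (h₁ x y).trans
    (mul_le_mul_of_nonneg_right ((le_max_left _ _).trans (le_max_right _ _)) (hd.nonneg x y))
  have hf' : ∀ x y, d (f⁻¹ x) (f⁻¹ y) ≤ K * d x y := fun x y => (h₂ x y).trans
    (mul_le_mul_of_nonneg_right ((le_max_right _ _).trans (le_max_right _ _)) (hd.nonneg x y))
  refine ⟨K, hK1, fun n x y => ?_⟩
  obtain ⟨m, rfl | rfl⟩ := n.eq_nat_or_neg
  · simpa using iter f hf m x y
  · simpa using iter f⁻¹ hf' m x y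

theorem IsAdaptedMetric.exists_distortion_bounds {M : Type*} [TopologicalSpace M] {f : M ≃ₜ M}
    {d : M → M → ℝ} (hd : IsAdaptedMetric f d) :
    ∃ K : ℝ, 1 ≤ K ∧ ∀ (n : ℤ) (x y : M), x ≠ y →
      (K ^ n.natAbs)⁻¹ ≤ d ((f ^ n) x) ((f ^ n) y) / d x y ∧
        d ((f ^ n) x) ((f ^ n) y) / d x y ≤ K ^ n.natAbs := by
  obtain ⟨K, hK, h⟩ := hd.exists_lipschitz_zpow
  refine ⟨K, hK, fun n x y hxy => ?_⟩
  have hpos := hd.pos_of_ne hxy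
  have hKn : 0 < K ^ n.natAbs := by positivity
  refine ⟨?_, (div_le_iff₀ hpos).2 (h n x y)⟩
  -- The lower bound is the Lipschitz bound for `f ^ (-n)` at the image points.
  have h' := h (-n) ((f ^ n) x) ((f ^ n) y)
  rw [← Homeomorph.mul_apply, ← Homeomorph.mul_apply, ← zpow_add, neg_add_cancel, zpow_zero,
    Int.natAbs_neg] at h'
  rw [le_div_iff₀ hpos, inv_mul_le_iff₀ hKn]
  exact h'

/-- Only finitely many iterates are constrained, so continuity gives a whole neighbourhood of `x`.
On an empty ball the supremum would be `0` and the infimum `∞`, both with infinite `|log|`. -/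
theorem IsAdaptedMetric.puncturedBowenBall_nonempty {M : Type*} [TopologicalSpace M]
    [PerfectSpace M] {f : M ≃ₜ M} {d : M → M → ℝ} (hd : IsAdaptedMetric f d) {δ : ℝ} (hδ : 0 < δ)
    (x : M) (n : ℤ) : (puncturedBowenBall d f δ x n).Nonempty := by
  have hev : ∀ᶠ y in 𝓝 x, ∀ j ∈ Set.uIcc (0 : ℤ) n, d ((f ^ j) x) ((f ^ j) y) ≤ δ := by
    rw [Filter.eventually_all_finite (Set.finite_uIcc (0 : ℤ) n)]
    intro j _
    have hc : Continuous fun y => d ((f ^ j) x) ((f ^ j) y) :=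
      hd.continuous_uncurry.comp (continuous_const.prodMk (f ^ j).continuous)
    have hlt : d ((f ^ j) x) ((f ^ j) x) < δ := by rwa [hd.self_eq_zero]
    exact (hc.continuousAt.eventually_lt continuousAt_const hlt).mono fun _ => le_of_lt
  obtain ⟨y, hy, hyx⟩ := ((hev.filter_mono nhdsWithin_le_nhds).and
    (self_mem_nhdsWithin : {x}ᶜ ∈ 𝓝[≠] x)).exists
  exact ⟨y, hyx, hy⟩

/-- The projection of the intersection of a closed and an open set along a compact metrizable
space is Borel. -/
theorem measurableSet_image_fst_inter {X Y : Type*} [MetricSpace X] [CompactSpace X]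
    [MeasurableSpace X] [BorelSpace X] [MetricSpace Y] [CompactSpace Y] {C U : Set (X × Y)}
    (hC : IsClosed C) (hU : IsOpen U) : MeasurableSet (Prod.fst '' (C ∩ U)) := by
  -- Open sets are `F_σ` in a metric space, so `C ∩ U` is a countable union of compact sets.
  obtain ⟨F, hF, -, hFU, -⟩ := hU.exists_iUnion_isClosed
  rw [← hFU, Set.inter_iUnion, Set.image_iUnion]
  exact MeasurableSet.iUnion fun m =>
    ((hC.inter (hF m)).isCompact.image continuous_fst).isClosed.measurableSet

/-- The distance constraints are closed in `M × M`. The quotient is continuous off the diagonal,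
which is where `y ≠ x` places it, so its condition is open. -/
theorem IsAdaptedMetric.measurableSet_exists_distortion_mem {M : Type*} [MetricSpace M]
    [CompactSpace M] [MeasurableSpace M] [BorelSpace M] {f : M ≃ₜ M} {d : M → M → ℝ}
    (hd : IsAdaptedMetric f d) (δ : ℝ) (n : ℤ) {V : Set ℝ≥0∞} (hV : IsOpen V) :
    MeasurableSet {x | ∃ y ∈ puncturedBowenBall d f δ x n,
      ENNReal.ofReal (d ((f ^ n) x) ((f ^ n) y) / d x y) ∈ V} := by
  have hcont : ∀ j : ℤ, Continuous fun p : M × M => d ((f ^ j) p.1) ((f ^ j) p.2) := fun j =>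
    hd.continuous_uncurry.comp (((f ^ j).continuous.comp continuous_fst).prodMk
      ((f ^ j).continuous.comp continuous_snd))
  have hC : IsClosed {p : M × M | ∀ j ∈ Set.uIcc (0 : ℤ) n,
      d ((f ^ j) p.1) ((f ^ j) p.2) ≤ δ} := by
    simp only [Set.ofPred_forall]
    exact isClosed_iInter fun j => isClosed_iInter fun _ =>
      isClosed_le (hcont j) continuous_const
  have hne : IsOpen {p : M × M | p.1 ≠ p.2} := isOpen_ne_fun continuous_fst continuous_snd
  have hq : ContinuousOn (fun p : M × M =>
      ENNReal.ofReal (d ((f ^ n) p.1) ((f ^ n) p.2) / d p.1 p.2)) {p | p.1 ≠ p.2} :=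
    ENNReal.continuous_ofReal.comp_continuousOn ((hcont n).continuousOn.div
      hd.continuous_uncurry.continuousOn fun p hp => (hd.pos_of_ne hp).ne')
  convert measurableSet_image_fst_inter hC (hq.isOpen_inter_preimage hne hV) using 1
  ext x
  simp only [puncturedBowenBall, Set.mem_ofPred_eq, Set.mem_image, Set.mem_inter_iff,
    Set.mem_preimage, Prod.exists, exists_and_right, exists_eq_right]
  exact exists_congr fun y => ⟨fun h => ⟨h.1.2, h.1.1.symm, h.2⟩,
    fun h => ⟨⟨h.2.1.symm, h.1⟩, h.2.2⟩⟩

theorem IsAdaptedMetric.measurable_maxDistortion {M : Type*} [MetricSpace M]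
    [CompactSpace M] [MeasurableSpace M] [BorelSpace M] {f : M ≃ₜ M} {d : M → M → ℝ}
    (hd : IsAdaptedMetric f d) (δ : ℝ) (n : ℤ) :
    Measurable fun x => maxDistortion d f δ x n := by
  -- The strict inequality matters: a supremum exceeds `c` exactly when some member does.
  refine measurable_of_Ioi fun c => ?_
  convert hd.measurableSet_exists_distortion_mem δ n (isOpen_Ioi (a := c)) using 1
  ext x
  simp [maxDistortion, lt_iSup_iff]

theorem IsAdaptedMetric.measurable_minDistortion {M : Type*} [MetricSpace M]
    [CompactSpace M] [MeasurableSpace M] [BorelSpace M] {f : M ≃ₜ M} {d : M → M → ℝ}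
    (hd : IsAdaptedMetric f d) (δ : ℝ) (n : ℤ) :
    Measurable fun x => minDistortion d f δ x n := by
  refine measurable_of_Iio fun c => ?_
  convert hd.measurableSet_exists_distortion_mem δ n (isOpen_Iio (a := c)) using 1
  ext x
  simp [minDistortion, iInf_lt_iff]

/-- The two bounds keep `g` away from `0` and `∞`, so the extended logarithm is the real one. -/
theorem ENNReal.abs_log_le {K : ℝ} (hK : 1 ≤ K) (N : ℕ) {g : ℝ≥0∞}
    (hl : ENNReal.ofReal (K ^ N)⁻¹ ≤ g) (hu : g ≤ ENNReal.ofReal (K ^ N)) :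
    (ENNReal.log g).abs ≤ N * ENNReal.ofReal (Real.log K) := by
  have hKN : 0 < K ^ N := by positivity
  lift g to NNReal using (hu.trans_lt ENNReal.ofReal_lt_top).ne
  have hl' : (K ^ N)⁻¹ ≤ (g : ℝ) := by
    simpa using (ENNReal.ofReal_le_iff_le_toReal ENNReal.coe_ne_top).1 hl
  have hu' : (g : ℝ) ≤ K ^ N := by
    simpa using (ENNReal.le_ofReal_iff_toReal_le ENNReal.coe_ne_top hKN.le).1 hu
  have hg : 0 < (g : ℝ) := (inv_pos.2 hKN).trans_le hl'
  have hlog : ENNReal.log g = ((Real.log g : ℝ) : EReal) := by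
    rw [ENNReal.log_pos_real (by simpa using hg.ne') ENNReal.coe_ne_top, ENNReal.coe_toReal]
  rw [hlog, EReal.abs_def, ← ENNReal.ofReal_natCast, ← ENNReal.ofReal_mul (Nat.cast_nonneg N)]
  refine ENNReal.ofReal_le_ofReal (abs_le.2 ⟨?_, ?_⟩)
  · rw [← Real.log_pow, ← Real.log_inv]
    exact Real.log_le_log (inv_pos.2 hKN) hl'
  · rw [← Real.log_pow]
    exact Real.log_le_log hg hu'

theorem supMeanAbsLog_lt_top {M : Type*} [MeasurableSpace M] (μ : Measure M)
    [IsProbabilityMeasure μ] {g : ℤ → M → ℝ≥0∞} {c : ℝ≥0∞} (hc : c < ∞)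
    (h : ∀ n x, (ENNReal.log (g n x)).abs ≤ n.natAbs * c) : supMeanAbsLog μ g < ∞ := by
  refine lt_of_le_of_lt (iSup₂_le fun n hn => ?_) hc
  have hn' : (n.natAbs : ℝ≥0∞) ≠ 0 := by simpa using hn
  calc meanAbsLog μ (g n) n ≤ (n.natAbs : ℝ≥0∞)⁻¹ * ∫⁻ _, n.natAbs * c ∂μ :=
        mul_le_mul_right (lintegral_mono (h n)) _
    _ = c := by
        rw [lintegral_const, measure_univ, mul_one, ← mul_assoc,
          ENNReal.inv_mul_cancel hn' (ENNReal.natCast_ne_top _), one_mul]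

theorem infMeanAbsLog_le_supMeanAbsLog {M : Type*} [MeasurableSpace M] (μ : Measure M)
    (g : ℤ → M → ℝ≥0∞) : infMeanAbsLog μ g ≤ supMeanAbsLog μ g :=
  (iInf₂_le 1 one_ne_zero).trans
    (le_iSup₂ (f := fun (n : ℤ) (_ : n ≠ 0) => meanAbsLog μ (g n) n) 1 one_ne_zero)

theorem lemma2p4 {M : Type*} [MetricSpace M] [CompactSpace M] [PerfectSpace M]
    [MeasurableSpace M] [BorelSpace M]
    (f : M ≃ₜ M) (hf : IsExpansiveHomeo f)
    (d : M → M → ℝ) (hd : IsAdaptedMetric f d)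
    (μ : Measure M) [IsProbabilityMeasure μ] (hμ : MeasurePreserving f μ μ)
    (δ : ℝ) (hδ : 0 < δ) :
    (∀ n : ℤ, Measurable (fun x => maxDistortion d f δ x n) ∧
      Measurable (fun x => minDistortion d f δ x n)) ∧
    supMeanAbsLog μ (fun n x => maxDistortion d f δ x n) < ∞ ∧
    supMeanAbsLog μ (fun n x => minDistortion d f δ x n) < ∞ ∧
    infMeanAbsLog μ (fun n x => minDistortion d f δ x n) < ∞ := by
  obtain ⟨K, hK, hbd⟩ := hd.exists_distortion_bounds
  have hmax : supMeanAbsLog μ (fun n x => maxDistortion d f δ x n) < ∞ := by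
    refine supMeanAbsLog_lt_top μ (ENNReal.ofReal_lt_top (r := Real.log K)) fun n x => ?_
    obtain ⟨y, hy⟩ := hd.puncturedBowenBall_nonempty hδ x n
    -- A single point of the ball bounds the supremum from below; the upper bound needs all of them.
    -- For the infimum the roles are exchanged.
    exact ENNReal.abs_log_le hK _
      (le_iSup₂_of_le y hy (ENNReal.ofReal_le_ofReal (hbd n x y hy.1.symm).1))
      (iSup₂_le fun z hz => ENNReal.ofReal_le_ofReal (hbd n x z hz.1.symm).2)
  have hmin : supMeanAbsLog μ (fun n x => minDistortion d f δ x n) < ∞ := by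
    refine supMeanAbsLog_lt_top μ (ENNReal.ofReal_lt_top (r := Real.log K)) fun n x => ?_
    obtain ⟨y, hy⟩ := hd.puncturedBowenBall_nonempty hδ x n
    exact ENNReal.abs_log_le hK _
      (le_iInf₂ fun z hz => ENNReal.ofReal_le_ofReal (hbd n x z hz.1.symm).1)
      (iInf₂_le_of_le y hy (ENNReal.ofReal_le_ofReal (hbd n x y hy.1.symm).2))
  exact ⟨fun n => ⟨hd.measurable_maxDistortion δ n, hd.measurable_minDistortion δ n⟩,
    hmax, hmin, (infMeanAbsLog_le_supMeanAbsLog μ _).trans_lt hmin⟩
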